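/- **Setting.** Let $G=(V,E)$ be an undirected graph, finite or infinite, possibly with multiple edges and self-loops, with an edge length $\ell_e>0$ for each $e\in E$ and a specified set $\partial\mathcal G\subseteq V$ of boundary vertices; the other vertices are called interior. Its geometric realization $\mathcal G$ consists of $V$ together with a closed interval of length $\ell_e$ from $u$ to $v$ for each edge $e=\{u,v\}$, with the path metric. Let $\mathcal V$ be the measure on $\mathcal G$ that gives mass $1$ to each vertex, and let $\mathcal E$ be the measure that is Lebesgue measure on each edge interior and vanishes on vertices (that is, vertex weights and edge weights are $\mathcal V(v)=a_e=1$). Let $C^1_{\rm Dir}(\mathcal G)$ be the set of continuous $f:\mathcal G\to\mathbb R$ that are differentiable with uniformly continuous derivative on each edge interior, whose support lies in a union of finitely many vertices and closed edges, and that vanish on $\partial\mathcal G$. Put $$\lambda=\inf_{f}\ \frac{\int_{\mathcal G}|\nabla f|^2\,d\mathcal E}{\int_{\mathcal G} f^2\,d\mathcal V},$$ where $f$ ranges over the elements of $C^1_{\rm Dir}(\mathcal G)$ with $\int f^2\,d\mathcal V\ne0$ (and $\lambda=\infty$ if there are none). For $A\subseteq V$ let $\Gamma(A)$ be the set of vertices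 (possibly belonging to $A$) that are joined by an edge to a vertex of $A$. For a real number $c\ge 0$, call $\mathcal G$ a *$c$-magnifier* if $|\Gamma(A)|\ge(1+c)|A|$ for every set $A$ of interior vertices. **Theorem (Alon).** Let $c\ge0$ and let $\mathcal G$ be a $c$-magnifier. 1. If $\ell_e=1$ for all $e\in E$, then $$\lambda\ \ge\ \frac{c^2}{2c^2+4}\qquad\text{and furthermore}\qquad \lambda\ \ge\ \frac{c^2}{4+2\lfloor c\rfloor+2(c-\lfloor c\rfloor)^2}.$$ 2. For arbitrary edge lengths, $$\lambda\ \ge\ \frac{1}{\sup_e\ell_e}\cdot\frac{c^2}{2c^2+4}\qquad\text{and}\qquad \lambda\ \ge\ \frac{1}{\sup_e\ell_e}\cdot\frac{c^2}{4+2\lfloor c\rfloor+2(c-\lfloor c\rfloor)^2},$$ where the right-hand sides are $0$ if $\sup_e\ell_e=\infty$ (if there are no edges, then there are no interior vertices and $\lambda=\infty$). 3. The second bound is at least as large as the first, and is strictly larger when $c>1$: $$\frac{c^2}{2c^2+4}\le\frac{c^2}{4+2\lfloor c\rfloor+2(c-\lfloor c\rfloor)^2},\qquad\text{with strict inequality for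 } c>1.$$ -/

import Mathlib

open MeasureTheory Set
open scoped ENNReal

/-- An undirected graph with vertex set `V` and edge set `E` (any sizes; multiple edges and
self-loops allowed), with a positive length `ℓ_e` for each edge, a boundary (a specified set of
vertices), a positive mass `𝒱(v)` for each vertex and a positive density `a_e` for each edge.
The edge `e` joins `src e` to `tgt e`; the order of the two end points only fixes the
parametrization of the interval `[0, ℓ_e]` belonging to `e` and carries no other meaning. -/
structure CalcGraph (V : Type*) (E : Type*) where
  src : E → V
  tgt : E → V
  length : E → ℝ
  length_pos : ∀ e, 0 < length e
  boundary : Set V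
  vertexWeight : V → ℝ
  vertexWeight_pos : ∀ v, 0 < vertexWeight v
  edgeWeight : E → ℝ
  edgeWeight_pos : ∀ e, 0 < edgeWeight e

namespace CalcGraph

variable {V E : Type*} (G : CalcGraph V E)

/-! ### The geometric realization -/

/-- The points of the geometric realization `𝒢`: the vertices, and the points of the open
interval `(0, ℓ_e)` for each edge `e`. -/
inductive Realization : Type _
  | vertex (v : V) : Realization
  | inner (e : E) (t : ℝ) (ht : t ∈ Ioo 0 (G.length e)) : Realization

variable {G} in
/-- A vertex as a point of the geometric realization. -/
abbrev vert (v : V) : G.Realization := Realization.vertex v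

open Classical in
/-- The parametrization of the closed edge `e` by `[0, ℓ_e]`, with `0 ↦ src e` and
`ℓ_e ↦ tgt e` (extended constantly to the left of `0` and to the right of `ℓ_e`). -/
noncomputable def edgePoint (e : E) (t : ℝ) : G.Realization :=
  if h : t ∈ Ioo 0 (G.length e) then Realization.inner e t h
  else if t ≤ 0 then Realization.vertex (G.src e) else Realization.vertex (G.tgt e)

/-- The closed edge `e`, as a subset of the geometric realization. -/
def edgeSet (e : E) : Set G.Realization := G.edgePoint e '' Icc 0 (G.length e)

/-- `G.HasPath x y r`: there is a path of length `r` from `x` to `y` that is a concatenation of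
finitely many segments, each contained in a closed edge. -/
inductive HasPath : G.Realization → G.Realization → ℝ → Prop
  | refl (x : G.Realization) : HasPath x x 0
  | step {x y z : G.Realization} {r : ℝ} (e : E) (s t : ℝ)
      (hs : s ∈ Icc 0 (G.length e)) (ht : t ∈ Icc 0 (G.length e))
      (hx : G.edgePoint e s = x) (hy : G.edgePoint e t = y) (h : HasPath y z r) :
      HasPath x z (|s - t| + r)

variable {G} in
theorem HasPath.nonneg {x y : G.Realization} {r : ℝ} (h : G.HasPath x y r) : 0 ≤ r := by
  induction h with
  | refl x => exact le_rfl
  | step e s t hs ht hx hy h ih => positivity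

variable {G} in
theorem HasPath.trans {x y z : G.Realization} {r q : ℝ} (h : G.HasPath x y r)
    (h' : G.HasPath y z q) : G.HasPath x z (r + q) := by
  induction h with
  | refl x => simpa using h'
  | step e s t hs ht hx hy h ih =>
    rw [add_assoc]
    exact HasPath.step e s t hs ht hx hy (ih h')

variable {G} in
theorem HasPath.symm {x y : G.Realization} {r : ℝ} (h : G.HasPath x y r) :
    G.HasPath y x r := by
  induction h with
  | refl x => exact HasPath.refl x
  | step e s t hs ht hx hy h ih =>
    have h1 := ih.trans (HasPath.step e t s ht hs hy hx (HasPath.refl _))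
    rwa [add_zero, abs_sub_comm, add_comm] at h1

/-- The path metric on the geometric realization: the distance of two points is the infimum of
the lengths of the paths joining them (`∞` if there is none). -/
noncomputable instance : PseudoEMetricSpace G.Realization where
  edist x y := ⨅ (r : ℝ) (_ : G.HasPath x y r), ENNReal.ofReal r
  edist_self x := by
    refine le_antisymm (iInf₂_le_of_le 0 (HasPath.refl x) ?_) bot_le
    simp
  edist_comm x y := by
    refine le_antisymm ?_ ?_ <;>
    exact le_iInf₂ fun r h => iInf₂_le_of_le r h.symm le_rfl
  edist_triangle x y z := by
    simp only [ENNReal.iInf_add, ENNReal.add_iInf]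
    refine le_iInf₂ fun r h => le_iInf₂ fun q h' => ?_
    refine iInf₂_le_of_le _ (h'.trans h) ?_
    exact ENNReal.ofReal_add_le

/-! ### The vertex measure and the edge measure -/

/-- A subset of the geometric realization is measurable when its trace on every closed edge is
Borel. -/
noncomputable instance : MeasurableSpace G.Realization :=
  ⨅ e : E, (inferInstance : MeasurableSpace ℝ).map (G.edgePoint e)

theorem measurable_edgePoint (e : E) : Measurable (G.edgePoint e) := fun _ hs =>
  (MeasurableSpace.measurableSet_iInf.1 hs) e

/-- The vertex measure `𝒱`: mass `𝒱(v)` at each vertex `v`. -/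
noncomputable def vertexMeasure : Measure G.Realization :=
  Measure.sum fun v : V => ENNReal.ofReal (G.vertexWeight v) • Measure.dirac (vert v)

/-- The edge measure `ℰ`: on the interior of each edge `e` it is `a_e` times Lebesgue measure,
and the vertices are null. -/
noncomputable def edgeMeasure : Measure G.Realization :=
  Measure.sum fun e : E => ENNReal.ofReal (G.edgeWeight e) •
    (volume.restrict (Ioo 0 (G.length e))).map (G.edgePoint e)

/-! ### Functions on the geometric realization -/

variable {G} in
/-- `f ∈ C¹(𝒢)`: `f` is continuous, and on each edge interior it is differentiable with a
uniformly continuous derivative. -/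
def IsC1 (f : G.Realization → ℝ) : Prop :=
  Continuous f ∧ ∀ e : E,
    DifferentiableOn ℝ (f ∘ G.edgePoint e) (Ioo 0 (G.length e)) ∧
    UniformContinuousOn (deriv (f ∘ G.edgePoint e)) (Ioo 0 (G.length e))

variable {G} in
/-- A subset of `𝒢` is of finite type if it lies in the union of finitely many vertices and
(closed) edges. -/
def IsFiniteType (Ω : Set G.Realization) : Prop :=
  ∃ (A : Set V) (B : Set E), A.Finite ∧ B.Finite ∧
    Ω ⊆ (vert '' A) ∪ ⋃ e ∈ B, G.edgeSet e

variable {G} in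
/-- `f ∈ C¹_Dir(𝒢)`: `f ∈ C¹(𝒢)`, the support of `f` is of finite type, and `f` vanishes on the
boundary. -/
def IsC1Dir (f : G.Realization → ℝ) : Prop :=
  IsC1 f ∧ IsFiniteType (tsupport f) ∧ ∀ v ∈ G.boundary, f (vert v) = 0

variable {G} in
/-- The gradient of `f`, a vector field on the edge interiors, given by its component in the
direction of the parametrization of each edge; the value at the vertices, where the gradient is
not defined, is immaterial. -/
noncomputable def grad (f : G.Realization → ℝ) : G.Realization → ℝ
  | .vertex _ => 0
  | .inner e t _ => deriv (f ∘ G.edgePoint e) t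

/-! ### The Rayleigh quotient and `λ` -/

variable {G} in
/-- `∫ |∇f|² dℰ`. -/
noncomputable def energy (f : G.Realization → ℝ) : ℝ≥0∞ :=
  ∫⁻ x, ENNReal.ofReal (|grad f x| ^ 2) ∂G.edgeMeasure

variable {G} in
/-- `∫ f² d𝒱`. -/
noncomputable def sqMass (f : G.Realization → ℝ) : ℝ≥0∞ :=
  ∫⁻ x, ENNReal.ofReal (f x ^ 2) ∂G.vertexMeasure

variable {G} in
/-- The Rayleigh quotient `ℛ(f) = ∫ |∇f|² dℰ / ∫ f² d𝒱`. -/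
noncomputable def rayleigh (f : G.Realization → ℝ) : ℝ≥0∞ := energy f / sqMass f

/-- `λ`, the infimum of the Rayleigh quotient over the `f ∈ C¹_Dir(𝒢)` for which it is defined,
i.e. `∫ f² d𝒱 ≠ 0` (so it is `∞` if there is no such `f`). -/
noncomputable def lam : ℝ≥0∞ :=
  ⨅ (f : G.Realization → ℝ) (_ : IsC1Dir f) (_ : sqMass f ≠ 0), rayleigh f

/-! ### Magnifiers -/

/-- `Γ(A)`: the vertices (possibly belonging to `A`) with an edge joining them to a vertex
of `A`. -/
def nbhd (A : Set V) : Set V :=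
  {v | ∃ a ∈ A, ∃ e : E, (G.src e = a ∧ G.tgt e = v) ∨ (G.src e = v ∧ G.tgt e = a)}

/-- `𝒢` is a `c`-magnifier: `|Γ(A)| ≥ (1 + c)|A|` for every set `A` of interior vertices. -/
def IsMagnifier (c : ℝ) : Prop :=
  ∀ A : Set V, A ⊆ G.boundaryᶜ →
    ENNReal.ofReal (1 + c) * (A.encard : ℝ≥0∞) ≤ ((G.nbhd A).encard : ℝ≥0∞)

end CalcGraph

/-! Let g be the restriction of a test function to the vertices, with finite support A of interior
vertices, and S = ∑ g². Magnification is Hall's condition for A, so there is a fractional matching h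
with entries in [0, 1], row sums r ≤ 1 + c on A and column sums at most 1. Then ∑ h(x,y)(g(x)² -
g(y)²) ≥ (r - 1)S. Factor g(x)² - g(y)² = (g(x) - g(y))(g(x) + g(y)) and apply Cauchy–Schwarz: one
factor is the discrete energy, the other is at most a constant times S
(`sq_mul_sum_sq_le_of_fractional_matching`). The constant comes from bounding the sum of h² along a
row by `floorAddSq r`, and along a column by 1. Matchings exist for rational r, and r tends to 1 + c
from below (`sq_mul_sum_sq_le`). On each edge, the energy of a function is at least (difference of
end values)² / length, which transfers the discrete inequality to λ. The weaker bound follows from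
`floorAddSq c ≤ c ^ 2`. -/

/-! ### Sums of squares of numbers in [0, 1] -/

/-- The largest possible sum of squares of finitely many numbers in `[0, 1]` with sum `s`. -/
noncomputable def floorAddSq (s : ℝ) : ℝ := ⌊s⌋ + (s - ⌊s⌋) ^ 2

theorem floorAddSq_one_add (c : ℝ) : floorAddSq (1 + c) = 1 + floorAddSq c := by
  unfold floorAddSq
  rw [add_comm 1 c, Int.floor_add_one]
  push_cast
  ring

theorem floorAddSq_mono : Monotone floorAddSq := by
  intro s t hst
  unfold floorAddSq
  have h1 := Int.floor_le s
  have h2 := Int.lt_floor_add_one s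
  have h3 := Int.floor_le t
  rcases (Int.floor_mono hst).eq_or_lt with h | h
  · rw [← h] at h3 ⊢
    have : (s - ⌊s⌋) ^ 2 ≤ (t - ⌊s⌋) ^ 2 := pow_le_pow_left₀ (by linarith) (by linarith) 2
    linarith
  · have h4 : (⌊s⌋ : ℝ) + 1 ≤ ⌊t⌋ := by exact_mod_cast h
    nlinarith [sq_nonneg (t - ⌊t⌋)]

/-- Let a be the fractional part of s. If s + t passes no integer, the gain is 2at; otherwise it is
1 + (a + t - 1)² - a² - t² = 2(1 - a)(1 - t). -/
theorem floorAddSq_add_sq_le (s t : ℝ) (ht : 0 ≤ t) (ht1 : t ≤ 1) :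
    floorAddSq s + t ^ 2 ≤ floorAddSq (s + t) := by
  unfold floorAddSq
  have h1 := Int.floor_le s
  have h2 := Int.lt_floor_add_one s
  rcases lt_or_ge (s + t) (⌊s⌋ + 1) with h | h
  · have : ⌊s + t⌋ = ⌊s⌋ := Int.floor_eq_iff.2 ⟨by linarith, h⟩
    rw [this]
    nlinarith [mul_nonneg (sub_nonneg.2 h1) ht]
  · have : ⌊s + t⌋ = ⌊s⌋ + 1 :=
      Int.floor_eq_iff.2 ⟨by push_cast; exact h, by push_cast; linarith⟩
    rw [this]
    push_cast
    nlinarith [mul_nonneg (sub_nonneg.2 h2.le) (sub_nonneg.2 ht1)]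

theorem sum_sq_le_floorAddSq {ι : Type*} (s : Finset ι) (h : ι → ℝ) (h0 : ∀ i ∈ s, 0 ≤ h i)
    (h1 : ∀ i ∈ s, h i ≤ 1) : ∑ i ∈ s, h i ^ 2 ≤ floorAddSq (∑ i ∈ s, h i) := by
  classical
  induction s using Finset.induction_on with
  | empty => simp [floorAddSq]
  | insert a s ha ih =>
    rw [Finset.sum_insert ha, Finset.sum_insert ha, add_comm, add_comm (h a)]
    have := ih (fun i hi => h0 i (Finset.mem_insert_of_mem hi))
      (fun i hi => h1 i (Finset.mem_insert_of_mem hi))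
    exact (add_le_add_left this _).trans (floorAddSq_add_sq_le _ _ (h0 a (Finset.mem_insert_self a s))
      (h1 a (Finset.mem_insert_self a s)))

/-! ### Fractional matchings from Hall's theorem -/

/-- A fractional form of Hall's theorem, for a rational demand `p / q` at each vertex of `A`. -/
theorem exists_fractional_matching {V : Type*} [DecidableEq V] (A : Finset V) (N : V → Finset V)
    (p q : ℕ) (hq : 0 < q) (hall : ∀ S ⊆ A, p * S.card ≤ q * (S.biUnion N).card) :
    ∃ h : V → V → ℝ, (∀ x y, 0 ≤ h x y) ∧ (∀ x y, h x y ≠ 0 → x ∈ A ∧ y ∈ N x) ∧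
      (∀ x ∈ A, ∑ y ∈ N x, h x y = p / q) ∧ ∀ y, ∑ x ∈ A, h x y ≤ 1 := by
  -- Hall's theorem with p copies of each vertex of A and q copies of each target.
  obtain ⟨φ, hφ, hφN⟩ := (Finset.all_card_le_biUnion_card_iff_exists_injective
    (fun k : A × Fin p => N k.1 ×ˢ (Finset.univ : Finset (Fin q)))).1 (by
      intro s
      have h1 : s.card ≤ p * ((s.image Prod.fst).image Subtype.val).card := by
        rw [Finset.card_image_of_injective _ Subtype.val_injective]
        calc s.card ≤ ((s.image Prod.fst) ×ˢ (Finset.univ : Finset (Fin p))).card :=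
              Finset.card_le_card fun k hk => Finset.mem_product.2
                ⟨Finset.mem_image_of_mem _ hk, Finset.mem_univ _⟩
          _ = _ := by rw [Finset.card_product, Finset.card_univ, Fintype.card_fin, mul_comm]
      refine h1.trans ((hall _ ?_).trans (le_of_eq ?_))
      · intro x hx
        obtain ⟨y, _, rfl⟩ := Finset.mem_image.1 hx
        exact y.2
      · have : s.biUnion (fun k : A × Fin p => N k.1 ×ˢ (Finset.univ : Finset (Fin q))) =
            (((s.image Prod.fst).image Subtype.val).biUnion N) ×ˢ Finset.univ := by
          ext ⟨y, j⟩
          simp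
        rw [this, Finset.card_product, Finset.card_univ, Fintype.card_fin, mul_comm])
  have hq' : (0 : ℝ) < q := by exact_mod_cast hq
  -- h(x,y) is the number of copies of x sent to copies of y, divided by q; injectivity bounds each
  -- column by q / q.
  refine ⟨fun x y => ((Finset.univ.filter fun k : A × Fin p =>
    (k.1 : V) = x ∧ (φ k).1 = y).card : ℝ) / q, fun x y => by positivity, ?_, ?_, ?_⟩
  · intro x y hxy
    have : (Finset.univ.filter fun k : A × Fin p => (k.1 : V) = x ∧ (φ k).1 = y).Nonempty := by
      rw [Finset.nonempty_iff_ne_empty]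
      intro h
      simp only [h, Finset.card_empty, Nat.cast_zero, zero_div, ne_eq, not_true_eq_false] at hxy
    obtain ⟨k, hk⟩ := this
    obtain ⟨-, rfl, rfl⟩ := Finset.mem_filter.1 hk
    exact ⟨k.1.2, (Finset.mem_product.1 (hφN k)).1⟩
  · intro x hx
    rw [← Finset.sum_div, ← Nat.cast_sum]
    congr 2
    have h1 := Finset.card_eq_sum_card_fiberwise (f := fun k : A × Fin p => (φ k).1)
      (s := Finset.univ.filter fun k : A × Fin p => (k.1 : V) = x) (t := N x) (by
        intro k hk
        obtain rfl := (Finset.mem_filter.1 hk).2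
        exact (Finset.mem_product.1 (hφN k)).1)
    simp only [Finset.filter_filter] at h1
    rw [← h1]
    have : (Finset.univ.filter fun k : A × Fin p => (k.1 : V) = x) =
        {(⟨x, hx⟩ : A)} ×ˢ Finset.univ := by
      ext ⟨a, i⟩
      simp [Subtype.ext_iff, eq_comm]
    rw [this, Finset.card_product]
    simp
  · intro y
    rw [← Finset.sum_div, ← Nat.cast_sum, div_le_one hq', Nat.cast_le]
    have h1 := Finset.card_eq_sum_card_fiberwise (f := fun k : A × Fin p => (k.1 : V))
      (s := Finset.univ.filter fun k : A × Fin p => (φ k).1 = y) (t := A)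
      (fun k _ => k.1.2)
    simp only [Finset.filter_filter, and_comm] at h1
    rw [← h1]
    calc _ ≤ ((Finset.univ : Finset (Fin q))).card := by
          refine Finset.card_le_card_of_injOn (fun k => (φ k).2) (fun _ _ => by simp) ?_
          intro k hk l hl hkl
          apply hφ
          simp only [Finset.coe_filter, Finset.mem_univ, true_and, Set.mem_ofPred_eq] at hk hl
          exact Prod.ext (hk.trans hl.symm) hkl
      _ = q := by simp

/-! ### The inequality carried by a fractional matching -/

/-- The Cauchy–Schwarz step: a fractional matching of the support of `g` into `W`, with demand
`r`, bounds `∑ g²` by the sum of the squared differences of `g` over the pairs it uses. -/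
theorem sq_mul_sum_sq_le_of_fractional_matching {V : Type*} (W A : Finset V)
    (g : V → ℝ) (hgA : ∀ x, x ∉ A → g x = 0) (r : ℝ) (hr : 1 ≤ r)
    (R : V → V → Prop) [DecidableRel R] (hR : ∀ x y, R x y → R y x)
    (h : V → V → ℝ) (h0 : ∀ x y, 0 ≤ h x y) (hA : ∀ x y, h x y ≠ 0 → x ∈ A ∧ R x y)
    (hrow : ∀ x ∈ A, ∑ y ∈ W, h x y = r) (hcol : ∀ y, ∑ x ∈ W, h x y ≤ 1) :
    (r - 1) ^ 2 * ∑ x ∈ W, g x ^ 2 ≤ (1 + floorAddSq r) *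
      ∑ x ∈ W, ∑ y ∈ W, if R x y then (g x - g y) ^ 2 else 0 := by
  set S := ∑ x ∈ W, g x ^ 2 with hS
  have hS0 : 0 ≤ S := Finset.sum_nonneg fun x _ => sq_nonneg _
  have hle1 : ∀ x ∈ W, ∀ y, h x y ≤ 1 := fun x hx y =>
    (Finset.single_le_sum (f := fun x => h x y) (fun z _ => h0 z y) hx).trans (hcol y)
  have hrow' : ∀ x, (∑ y ∈ W, h x y) * g x ^ 2 = r * g x ^ 2 := by
    intro x
    by_cases hx : x ∈ A
    · rw [hrow x hx]
    · simp [hgA x hx]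
  -- Full rows contribute exactly rS, and the columns take away at most S.
  have hflow : (r - 1) * S ≤ ∑ x ∈ W, ∑ y ∈ W, h x y * (g x ^ 2 - g y ^ 2) := by
    have e1 : ∑ x ∈ W, ∑ y ∈ W, h x y * g x ^ 2 = r * S := by
      rw [hS, Finset.mul_sum]
      exact Finset.sum_congr rfl fun x _ => by rw [← Finset.sum_mul, hrow']
    have e2 : ∑ x ∈ W, ∑ y ∈ W, h x y * g y ^ 2 ≤ S := by
      rw [Finset.sum_comm]
      refine Finset.sum_le_sum fun y _ => ?_
      rw [← Finset.sum_mul]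
      exact mul_le_of_le_one_left (sq_nonneg _) (hcol y)
    simp only [mul_sub, Finset.sum_sub_distrib]
    linarith
  -- Rows are bounded by `floorAddSq`, columns by h² ≤ h.
  have hsq : ∑ x ∈ W, ∑ y ∈ W, h x y ^ 2 * (g x ^ 2 + g y ^ 2) ≤ (1 + floorAddSq r) * S := by
    have e1 : ∑ x ∈ W, ∑ y ∈ W, h x y ^ 2 * g x ^ 2 ≤ floorAddSq r * S := by
      rw [hS, Finset.mul_sum]
      refine Finset.sum_le_sum fun x hx => ?_
      by_cases hxA : x ∈ A
      · rw [← Finset.sum_mul, ← hrow x hxA]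
        exact mul_le_mul_of_nonneg_right
          (sum_sq_le_floorAddSq W _ (fun y _ => h0 x y) (fun y _ => hle1 x hx y)) (sq_nonneg _)
      · simp [hgA x hxA]
    have e2 : ∑ x ∈ W, ∑ y ∈ W, h x y ^ 2 * g y ^ 2 ≤ S := by
      rw [Finset.sum_comm]
      refine Finset.sum_le_sum fun y _ => ?_
      rw [← Finset.sum_mul]
      refine mul_le_of_le_one_left (sq_nonneg _) (le_trans ?_ (hcol y))
      exact Finset.sum_le_sum fun x hx => by nlinarith [h0 x y, hle1 x hx y]
    simp only [mul_add, Finset.sum_add_distrib]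
    linarith
  -- D counts ordered pairs, so both orientations are available. Antisymmetrizing doubles the flow,
  -- while h ≥ 0 gives k² ≤ h² + (hᵀ)² with no cross term; this saves a factor 2.
  set k : V → V → ℝ := fun x y => h x y - h y x with hk
  have hanti : 2 * ∑ x ∈ W, ∑ y ∈ W, h x y * (g x ^ 2 - g y ^ 2) =
      ∑ x ∈ W, ∑ y ∈ W, k x y * (g x ^ 2 - g y ^ 2) := by
    have e : ∑ x ∈ W, ∑ y ∈ W, h y x * (g x ^ 2 - g y ^ 2) =
        - ∑ x ∈ W, ∑ y ∈ W, h x y * (g x ^ 2 - g y ^ 2) := by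
      rw [Finset.sum_comm, ← Finset.sum_neg_distrib]
      refine Finset.sum_congr rfl fun x _ => ?_
      rw [← Finset.sum_neg_distrib]
      exact Finset.sum_congr rfl fun y _ => by ring
    simp only [hk, sub_mul _ _ (_ - _), Finset.sum_sub_distrib, e]
    ring
  have hksq : ∑ x ∈ W, ∑ y ∈ W, (k x y * (g x + g y)) ^ 2 ≤
      4 * ((1 + floorAddSq r) * S) := by
    have e : ∑ x ∈ W, ∑ y ∈ W, h y x ^ 2 * (g x ^ 2 + g y ^ 2) =
        ∑ x ∈ W, ∑ y ∈ W, h x y ^ 2 * (g x ^ 2 + g y ^ 2) := by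
      rw [Finset.sum_comm]
      exact Finset.sum_congr rfl fun x _ => Finset.sum_congr rfl fun y _ => by ring
    have : ∑ x ∈ W, ∑ y ∈ W, (k x y * (g x + g y)) ^ 2 ≤
        ∑ x ∈ W, ∑ y ∈ W, (2 * (h x y ^ 2 * (g x ^ 2 + g y ^ 2)) +
          2 * (h y x ^ 2 * (g x ^ 2 + g y ^ 2))) := by
      refine Finset.sum_le_sum fun x _ => Finset.sum_le_sum fun y _ => ?_
      have i1 : k x y ^ 2 ≤ h x y ^ 2 + h y x ^ 2 := by
        simp only [hk]; nlinarith [mul_nonneg (h0 x y) (h0 y x)]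
      have i2 : (g x + g y) ^ 2 ≤ 2 * (g x ^ 2 + g y ^ 2) := by nlinarith [sq_nonneg (g x - g y)]
      rw [mul_pow]
      calc _ ≤ (h x y ^ 2 + h y x ^ 2) * (2 * (g x ^ 2 + g y ^ 2)) :=
            mul_le_mul i1 i2 (sq_nonneg _) (by positivity)
        _ = _ := by ring
    simp only [Finset.sum_add_distrib, ← Finset.mul_sum, e] at this
    linarith
  set D := ∑ x ∈ W, ∑ y ∈ W, if R x y then (g x - g y) ^ 2 else 0 with hD
  have hD0 : 0 ≤ D := Finset.sum_nonneg fun x _ => Finset.sum_nonneg fun y _ => by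
    split_ifs <;> positivity
  have hCS : (∑ x ∈ W, ∑ y ∈ W, k x y * (g x ^ 2 - g y ^ 2)) ^ 2 ≤
      D * ∑ x ∈ W, ∑ y ∈ W, (k x y * (g x + g y)) ^ 2 := by
    have e := Finset.sum_mul_sq_le_sq_mul_sq (W ×ˢ W)
      (fun z => if R z.1 z.2 then g z.1 - g z.2 else 0) (fun z => k z.1 z.2 * (g z.1 + g z.2))
    simp only [Finset.sum_product, ite_pow, zero_pow two_ne_zero] at e
    refine le_trans (le_of_eq ?_) e
    congr 1
    refine Finset.sum_congr rfl fun x _ => Finset.sum_congr rfl fun y _ => ?_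
    split_ifs with hxy
    · ring
    -- Off the symmetric relation R both orientations of h vanish, hence so does k.
    · have h1 : h x y = 0 := by_contra fun hne => hxy (hA x y hne).2
      have h2 : h y x = 0 := by_contra fun hne => hxy (hR _ _ (hA y x hne).2)
      simp [hk, h1, h2]
  rcases hS0.eq_or_lt with hz | hpos
  · rw [← hz, mul_zero]
    refine mul_nonneg ?_ hD0
    have : (0 : ℝ) ≤ floorAddSq r := by
      have := floorAddSq_mono (show (0 : ℝ) ≤ r by linarith)
      simpa [floorAddSq] using this
    linarith
  · have f1 : (2 * ((r - 1) * S)) ^ 2 ≤ D * (4 * ((1 + floorAddSq r) * S)) := by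
      refine le_trans ?_ (hCS.trans (mul_le_mul_of_nonneg_left hksq hD0))
      refine pow_le_pow_left₀ (mul_nonneg zero_le_two (mul_nonneg (by linarith) hS0)) ?_ 2
      rw [← hanti]
      linarith
    refine le_of_mul_le_mul_right ?_ hpos
    nlinarith

/-! ### Energy along one edge -/

/-- Cauchy–Schwarz on an interval: `(F b - F a)² ≤ (b - a) ∫ |F'|²`. -/
theorem ofReal_sq_sub_div_le_lintegral_sq_deriv (F : ℝ → ℝ) (l : ℝ) (hl : 0 < l)
    (hc : ContinuousOn F (Icc 0 l)) (hd : DifferentiableOn ℝ F (Ioo 0 l)) :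
    ENNReal.ofReal ((F 0 - F l) ^ 2) / ENNReal.ofReal l ≤
      ∫⁻ t in Ioo 0 l, ENNReal.ofReal (|deriv F t| ^ 2) := by
  simp only [sq_abs]
  set μ := volume.restrict (Ioo (0 : ℝ) l) with hμ
  -- An infinite integral makes the claim trivial; a finite one makes the derivative square
  -- integrable, hence integrable.
  rcases eq_or_ne (∫⁻ t, ENNReal.ofReal (deriv F t ^ 2) ∂μ) ⊤ with htop | hfin
  · rw [htop]; exact le_top
  have hm : Measurable (deriv F) := measurable_deriv F
  have hsq : Integrable (fun t => deriv F t ^ 2) μ := by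
    refine ⟨(hm.pow_const 2).aestronglyMeasurable, ?_⟩
    rw [hasFiniteIntegral_iff_ofReal (Filter.Eventually.of_forall fun t => sq_nonneg _)]
    exact hfin.lt_top
  have hint : Integrable (deriv F) μ :=
    ((memLp_two_iff_integrable_sq hm.aestronglyMeasurable).2 hsq).integrable one_le_two
  have hftc : ∫ t, deriv F t ∂μ = F l - F 0 := by
    rw [hμ, ← integral_Ioc_eq_integral_Ioo, ← intervalIntegral.integral_of_le hl.le]
    refine intervalIntegral.integral_eq_sub_of_hasDerivAt_of_le hl.le hc (fun t ht =>
      ((hd t ht).differentiableAt (isOpen_Ioo.mem_nhds ht)).hasDerivAt) ?_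
    rw [intervalIntegrable_iff_integrableOn_Ioo_of_le hl.le]
    exact hint
  have hreal : (F 0 - F l) ^ 2 / l ≤ ∫ t, deriv F t ^ 2 ∂μ := by
    -- The mean slope: integrating (F' - m)² ≥ 0 gives the bound.
    set m := (F l - F 0) / l with hm'
    have h1 : ∫ t, (2 * m * deriv F t - m ^ 2) ∂μ ≤ ∫ t, deriv F t ^ 2 ∂μ := by
      refine integral_mono ((hint.const_mul _).sub (integrable_const _)) hsq fun t => ?_
      nlinarith [sq_nonneg (deriv F t - m)]
    rw [integral_sub (hint.const_mul _) (integrable_const _), integral_const_mul, hftc,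
      integral_const] at h1
    have h2 : μ.real univ = l := by simp [hμ, Measure.real, hl.le]
    rw [h2, smul_eq_mul] at h1
    refine le_trans (le_of_eq ?_) h1
    rw [hm']
    field_simp
    ring
  rw [← ENNReal.ofReal_div_of_pos hl, ← ofReal_integral_eq_lintegral_ofReal hsq
    (Filter.Eventually.of_forall fun t => sq_nonneg _)]
  exact ENNReal.ofReal_le_ofReal hreal

/-! ### From the realization to vertex values -/

namespace CalcGraph

variable {V E : Type*} (G : CalcGraph V E)

theorem edgePoint_of_mem {e : E} {t : ℝ} (ht : t ∈ Ioo 0 (G.length e)) :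
    G.edgePoint e t = Realization.inner e t ht := dif_pos ht

theorem edgePoint_zero (e : E) : G.edgePoint e 0 = vert (G.src e) := by
  simp [edgePoint]

theorem edgePoint_length (e : E) : G.edgePoint e (G.length e) = vert (G.tgt e) := by
  simp [edgePoint, G.length_pos e]

theorem edist_edgePoint_le {e : E} {s t : ℝ} (hs : s ∈ Icc 0 (G.length e))
    (ht : t ∈ Icc 0 (G.length e)) :
    edist (G.edgePoint e s) (G.edgePoint e t) ≤ edist s t := by
  rw [edist_dist, Real.dist_eq, ← add_zero |s - t|]
  exact iInf₂_le _ (HasPath.step e s t hs ht rfl rfl (HasPath.refl _))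

theorem continuousOn_edgePoint (e : E) :
    ContinuousOn (G.edgePoint e) (Icc 0 (G.length e)) :=
  LipschitzOnWith.continuousOn (K := 1) fun _ hs _ ht => by
    simpa using G.edist_edgePoint_le hs ht

variable {G}

theorem measurable_grad (f : G.Realization → ℝ) : Measurable (grad f) := by
  intro s hs
  refine MeasurableSpace.measurableSet_iInf.2 fun e => ?_
  have h : grad f ∘ G.edgePoint e =
      (Ioo 0 (G.length e)).indicator (deriv (f ∘ G.edgePoint e)) := by
    funext t
    by_cases ht : t ∈ Ioo 0 (G.length e)
    · rw [indicator_of_mem ht, Function.comp_apply, edgePoint_of_mem G ht]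
      rfl
    · rw [indicator_of_notMem ht, Function.comp_apply, edgePoint, dif_neg ht]
      split_ifs <;> rfl
  have hm : Measurable (grad f ∘ G.edgePoint e) := by
    rw [h]
    exact (measurable_deriv _).indicator measurableSet_Ioo
  exact hm hs

theorem energy_eq_tsum (f : G.Realization → ℝ) :
    energy f = ∑' e, ENNReal.ofReal (G.edgeWeight e) *
      ∫⁻ t in Ioo 0 (G.length e), ENNReal.ofReal (|deriv (f ∘ G.edgePoint e) t| ^ 2) := by
  rw [energy, edgeMeasure, lintegral_sum_measure]
  congr 1
  funext e
  have hm : Measurable fun x : G.Realization => ENNReal.ofReal (|grad f x| ^ 2) :=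
    ((measurable_abs.comp (measurable_grad f)).pow_const 2).ennreal_ofReal
  rw [lintegral_smul_measure, lintegral_map hm (G.measurable_edgePoint e), smul_eq_mul]
  congr 1
  refine setLIntegral_congr_fun measurableSet_Ioo fun t ht => ?_
  simp only [edgePoint_of_mem G ht, grad]

theorem tsum_sq_sub_div_le_energy (ha : ∀ e, G.edgeWeight e = 1) {f : G.Realization → ℝ}
    (hf : IsC1 f) :
    ∑' e, ENNReal.ofReal ((f (vert (G.src e)) - f (vert (G.tgt e))) ^ 2) /
      ENNReal.ofReal (G.length e) ≤ energy f := by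
  rw [energy_eq_tsum]
  refine ENNReal.tsum_le_tsum fun e => ?_
  rw [ha e, ENNReal.ofReal_one, one_mul, ← edgePoint_zero, ← edgePoint_length]
  exact ofReal_sq_sub_div_le_lintegral_sq_deriv (f ∘ G.edgePoint e) _ (G.length_pos e)
    (hf.1.comp_continuousOn (G.continuousOn_edgePoint e)) (hf.2 e).1

theorem sqMass_le_tsum (hV : ∀ v, G.vertexWeight v = 1) (f : G.Realization → ℝ) :
    sqMass f ≤ ∑' v, ENNReal.ofReal (f (vert v) ^ 2) := by
  rw [sqMass, vertexMeasure, lintegral_sum_measure]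
  refine ENNReal.tsum_le_tsum fun v => ?_
  -- A measurable minorant with the same integral avoids proving f measurable; only an upper bound
  -- on the mass is needed.
  obtain ⟨g, hg, hgf, h⟩ := exists_measurable_le_lintegral_eq
    (ENNReal.ofReal (G.vertexWeight v) • Measure.dirac (vert v : G.Realization))
    (fun x => ENNReal.ofReal (f x ^ 2))
  rw [h, hV v, ENNReal.ofReal_one, one_smul, lintegral_dirac' _ hg]
  exact hgf _

/-- A continuous function with support of finite type vanishes at the end points of all but
finitely many edges. -/
theorem exists_finset_edges {f : G.Realization → ℝ} (hf : Continuous f)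
    (hs : IsFiniteType (tsupport f)) :
    ∃ B : Finset E, ∀ e ∉ B, f (vert (G.src e)) = 0 ∧ f (vert (G.tgt e)) = 0 := by
  obtain ⟨A, B, -, hB, hsub⟩ := hs
  refine ⟨hB.toFinset, fun e he => ?_⟩
  rw [Set.Finite.mem_toFinset] at he
  have hpos := G.length_pos e
  -- An interior point of e lies on no other closed edge and is no vertex, so it is outside the
  -- support; continuity then reaches the end points.
  have h0 : ∀ t ∈ Ioo 0 (G.length e), (f ∘ G.edgePoint e) t = 0 := by
    intro t ht
    by_contra hne
    rcases hsub (subset_tsupport f hne) with ⟨v, -, hv⟩ | hU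
    · rw [edgePoint_of_mem G ht] at hv
      cases hv
    · obtain ⟨e', he', s, -, hs⟩ := mem_iUnion₂.1 hU
      rw [edgePoint_of_mem G ht, edgePoint] at hs
      split_ifs at hs
      cases hs
      exact he he'
  have h1 : ∀ t ∈ Icc 0 (G.length e), (f ∘ G.edgePoint e) t = 0 := by
    intro t ht
    have hcont : ContinuousOn (f ∘ G.edgePoint e) (closure (Ioo 0 (G.length e))) := by
      rw [closure_Ioo hpos.ne]
      exact hf.comp_continuousOn (G.continuousOn_edgePoint e)
    exact (Set.EqOn.of_subset_closure (f := f ∘ G.edgePoint e) (g := fun _ => (0 : ℝ))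
      (fun t ht => h0 t ht) hcont continuousOn_const subset_closure subset_rfl)
      (by rwa [closure_Ioo hpos.ne])
  constructor
  · simpa [edgePoint_zero] using h1 0 ⟨le_rfl, hpos.le⟩
  · simpa [edgePoint_length] using h1 _ ⟨hpos.le, le_rfl⟩

theorem finite_vertex_support {f : G.Realization → ℝ} (hs : IsFiniteType (tsupport f)) :
    {v | f (vert v) ≠ 0}.Finite := by
  obtain ⟨A, B, hA, hB, hsub⟩ := hs
  refine (hA.union ((hB.image G.src).union (hB.image G.tgt))).subset fun v hv => ?_
  rcases hsub (subset_tsupport f hv) with ⟨w, hw, h⟩ | hU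
  · cases h
    exact Or.inl hw
  · obtain ⟨e, he, s, -, h⟩ := mem_iUnion₂.1 hU
    rw [edgePoint] at h
    split_ifs at h
    · cases h
      exact Or.inr (Or.inl ⟨e, he, rfl⟩)
    · cases h
      exact Or.inr (Or.inr ⟨e, he, rfl⟩)

/-! ### The discrete inequality for magnifiers -/

/-- The vertices joined to `x` by an edge of the finite set `B`. -/
noncomputable def finNbhd (G : CalcGraph V E) (B : Finset E) (x : V) : Finset V := by
  classical
  exact B.biUnion fun e =>
    (if G.src e = x then {G.tgt e} else ∅) ∪ (if G.tgt e = x then {G.src e} else ∅)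

theorem mem_finNbhd {B : Finset E} {x y : V} : y ∈ G.finNbhd B x ↔
    ∃ e ∈ B, (G.src e = x ∧ G.tgt e = y) ∨ (G.src e = y ∧ G.tgt e = x) := by
  classical
  simp only [finNbhd, Finset.mem_biUnion, Finset.mem_union]
  refine exists_congr fun e => and_congr_right fun _ => or_congr ?_ ?_
  · split_ifs with h <;> simp [h, eq_comm]
  · split_ifs with h <;> simp [h, eq_comm]

theorem mem_finNbhd_symm {B : Finset E} {x y : V} (h : y ∈ G.finNbhd B x) :
    x ∈ G.finNbhd B y := by
  obtain ⟨e, he, h⟩ := mem_finNbhd.1 h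
  exact mem_finNbhd.2 ⟨e, he, h.symm⟩

-- Each edge accounts for at most two ordered pairs, one per orientation; parallel edges only
-- enlarge the right side.
open Classical in
theorem sum_finNbhd_sq_sub_le (W : Finset V) (B : Finset E) (g : V → ℝ) :
    (∑ x ∈ W, ∑ y ∈ W, if y ∈ G.finNbhd B x then (g x - g y) ^ 2 else 0) ≤
      2 * ∑ e ∈ B, (g (G.src e) - g (G.tgt e)) ^ 2 := by
  have key : ∀ u v : V, ∑ x ∈ W, ∑ y ∈ W, (if u = x ∧ v = y then (g x - g y) ^ 2 else 0) ≤
      (g u - g v) ^ 2 := by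
    intro u v
    simp only [ite_and, Finset.sum_ite_irrel, Finset.sum_const_zero, Finset.sum_ite_eq]
    split_ifs <;> first | exact le_rfl | positivity
  have h1 : (∑ x ∈ W, ∑ y ∈ W, if y ∈ G.finNbhd B x then (g x - g y) ^ 2 else 0) ≤
      ∑ x ∈ W, ∑ y ∈ W, ∑ e ∈ B,
        ((if G.src e = x ∧ G.tgt e = y then (g x - g y) ^ 2 else 0) +
          (if G.tgt e = x ∧ G.src e = y then (g x - g y) ^ 2 else 0)) := by
    refine Finset.sum_le_sum fun x _ => Finset.sum_le_sum fun y _ => ?_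
    have hnn : ∀ e ∈ B, 0 ≤ ((if G.src e = x ∧ G.tgt e = y then (g x - g y) ^ 2 else 0) +
          (if G.tgt e = x ∧ G.src e = y then (g x - g y) ^ 2 else 0)) := fun e _ => by
      split_ifs <;> positivity
    split_ifs with h
    · obtain ⟨e, he, h⟩ := mem_finNbhd.1 h
      refine le_trans ?_ (Finset.single_le_sum hnn he)
      rcases h with h | h
      · rw [if_pos h]
        exact le_add_of_nonneg_right (by split_ifs <;> positivity)
      · rw [if_pos h.symm]
        exact le_add_of_nonneg_left (by split_ifs <;> positivity)
    · exact Finset.sum_nonneg hnn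
  refine h1.trans ?_
  rw [Finset.mul_sum]
  have h2 : ∀ F : V → V → E → ℝ, ∑ x ∈ W, ∑ y ∈ W, ∑ e ∈ B, F x y e =
      ∑ e ∈ B, ∑ x ∈ W, ∑ y ∈ W, F x y e := fun F => by
    rw [Finset.sum_comm]
    simp only [Finset.sum_comm (s := W) (t := B)]
    exact Finset.sum_congr rfl fun e _ => Finset.sum_comm
  rw [h2]
  refine Finset.sum_le_sum fun e _ => ?_
  simp only [Finset.sum_add_distrib]
  have e1 := key (G.src e) (G.tgt e)
  have e2 := key (G.tgt e) (G.src e)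
  nlinarith

/-- The discrete inequality, for a rational magnification constant `p / q - 1`. -/
theorem rat_sq_mul_sum_sq_le {c : ℝ} (hc : 0 ≤ c) (hG : G.IsMagnifier c) (A : Finset V)
    (B : Finset E) (g : V → ℝ) (hgA : ∀ x, x ∈ A ↔ g x ≠ 0) (hgb : ∀ v ∈ G.boundary, g v = 0)
    (hB : ∀ e ∉ B, g (G.src e) = 0 ∧ g (G.tgt e) = 0) (r : ℚ) (hr : 1 ≤ r) (hrc : (r : ℝ) ≤ 1 + c) :
    ((r : ℝ) - 1) ^ 2 * ∑ x ∈ A, g x ^ 2 ≤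
      2 * (2 + floorAddSq c) * ∑ e ∈ B, (g (G.src e) - g (G.tgt e)) ^ 2 := by
  classical
  obtain ⟨p, hp⟩ := Int.eq_ofNat_of_zero_le (Rat.num_nonneg.2 (zero_le_one.trans hr))
  have hrpq : (r : ℝ) = (p : ℝ) / (r.den : ℝ) := by
    rw [Rat.cast_def, hp]
    simp
  have hden : (0 : ℝ) < r.den := by exact_mod_cast r.den_pos
  obtain ⟨h, h0, hsupp, hrow, hcol⟩ := exists_fractional_matching A (G.finNbhd B) p r.den
    r.den_pos (by
      intro S hS
      have hSb : (S : Set V) ⊆ G.boundaryᶜ := fun v hv hb => (hgA v).1 (hS hv) (hgb v hb)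
      -- Every edge meeting the support of g lies in B, so B already sees all of Γ(S).
      have hn : G.nbhd (S : Set V) ⊆ ((S.biUnion (G.finNbhd B) : Finset V) : Set V) := by
        rintro v ⟨a, ha, e, he⟩
        refine Finset.mem_coe.2 (Finset.mem_biUnion.2 ⟨a, ha, mem_finNbhd.2 ⟨e, ?_, he⟩⟩)
        by_contra heB
        have ha0 := (hgA a).1 (hS ha)
        rcases he with ⟨h, -⟩ | ⟨-, h⟩
        · exact ha0 (h ▸ (hB e heB).1)
        · exact ha0 (h ▸ (hB e heB).2)
      have h1 := (hG S hSb).trans (ENat.toENNReal_le.2 (encard_le_encard hn))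
      rw [Set.encard_coe_eq_coe_finsetCard, Set.encard_coe_eq_coe_finsetCard,
        ENat.toENNReal_coe, ENat.toENNReal_coe, ← ENNReal.ofReal_natCast,
        ← ENNReal.ofReal_natCast, ← ENNReal.ofReal_mul (by linarith),
        ENNReal.ofReal_le_ofReal_iff (by positivity)] at h1
      have h2 : (r : ℝ) * S.card ≤ (S.biUnion (G.finNbhd B)).card :=
        (mul_le_mul_of_nonneg_right hrc (by positivity)).trans h1
      rw [hrpq, div_mul_eq_mul_div, div_le_iff₀ hden, mul_comm _ (r.den : ℝ)] at h2
      exact_mod_cast h2)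
  set W := A ∪ A.biUnion (G.finNbhd B) with hW
  have hAW : A ⊆ W := Finset.subset_union_left
  have hr' : (1 : ℝ) ≤ r := by exact_mod_cast hr
  have hmain := sq_mul_sum_sq_le_of_fractional_matching W A g
    (fun x hx => by_contra fun hne => hx ((hgA x).2 hne)) r hr'
    (fun x y => y ∈ G.finNbhd B x) (fun _ _ => mem_finNbhd_symm) h h0 hsupp
    (fun x hx => by
      rw [hrpq, ← hrow x hx]
      refine (Finset.sum_subset (fun y hy => Finset.mem_union_right _
        (Finset.mem_biUnion.2 ⟨x, hx, hy⟩)) fun y _ hy => ?_).symm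
      exact by_contra fun hne => hy (hsupp x y hne).2)
    (fun y => by
      rw [← Finset.sum_subset hAW fun x _ hx => by_contra fun hne => hx (hsupp x y hne).1]
      exact hcol y)
  rw [← Finset.sum_subset hAW fun x _ hx => by
    rw [by_contra fun hne => hx ((hgA x).2 hne : x ∈ A), zero_pow two_ne_zero]] at hmain
  -- The shift by 1 turns the factor 1 + `floorAddSq r` into 2 + `floorAddSq c`.
  have hΦ : floorAddSq r ≤ 1 + floorAddSq c := floorAddSq_one_add c ▸ floorAddSq_mono hrc
  have hΦ0 : 0 ≤ floorAddSq r := by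
    simpa [floorAddSq] using floorAddSq_mono (zero_le_one.trans hr')
  have hD := sum_finNbhd_sq_sub_le (G := G) W B g
  refine hmain.trans ?_
  calc _ ≤ (1 + floorAddSq r) * (2 * ∑ e ∈ B, (g (G.src e) - g (G.tgt e)) ^ 2) := by
        refine mul_le_mul_of_nonneg_left ?_ (by linarith)
        convert hD
    _ ≤ (2 + floorAddSq c) * (2 * ∑ e ∈ B, (g (G.src e) - g (G.tgt e)) ^ 2) :=
        mul_le_mul_of_nonneg_right (by linarith) (by positivity)
    _ = _ := by ring

/-- The right side of the rational case does not involve r, so only (r - 1)² has to pass to the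
limit. -/
theorem sq_mul_sum_sq_le {c : ℝ} (hc : 0 ≤ c) (hG : G.IsMagnifier c) (A : Finset V)
    (B : Finset E) (g : V → ℝ) (hgA : ∀ x, x ∈ A ↔ g x ≠ 0) (hgb : ∀ v ∈ G.boundary, g v = 0)
    (hB : ∀ e ∉ B, g (G.src e) = 0 ∧ g (G.tgt e) = 0) :
    c ^ 2 * ∑ x ∈ A, g x ^ 2 ≤
      2 * (2 + floorAddSq c) * ∑ e ∈ B, (g (G.src e) - g (G.tgt e)) ^ 2 := by
  have hΦ0 : 0 ≤ floorAddSq c := by simpa [floorAddSq] using floorAddSq_mono hc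
  rcases hc.eq_or_lt with rfl | hpos
  · rw [zero_pow two_ne_zero, zero_mul]
    positivity
  have hlim : Filter.Tendsto (fun x : ℝ => x ^ 2 * ∑ x ∈ A, g x ^ 2) (nhdsWithin c (Iio c))
      (nhds (c ^ 2 * ∑ x ∈ A, g x ^ 2)) :=
    (Continuous.tendsto (by fun_prop) c).mono_left nhdsWithin_le_nhds
  refine le_of_tendsto hlim ?_
  filter_upwards [Ioo_mem_nhdsLT hpos] with x hx
  obtain ⟨q, hxq, hqc⟩ := exists_rat_btwn (show 1 + x < 1 + c by linarith [hx.2])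
  refine le_trans ?_ (rat_sq_mul_sum_sq_le hc hG A B g hgA hgb hB q ?_ hqc.le)
  · refine mul_le_mul_of_nonneg_right ?_ (Finset.sum_nonneg fun _ _ => sq_nonneg _)
    exact pow_le_pow_left₀ hx.1.le (by linarith) 2
  · have : (1 : ℝ) ≤ q := by linarith [hx.1]
    exact_mod_cast this

/-! ### The bound on λ and the comparison of constants -/

theorem div_iSup_length_le_lam (hV : ∀ v, G.vertexWeight v = 1) (ha : ∀ e, G.edgeWeight e = 1)
    {c : ℝ} (hc : 0 ≤ c) (hG : G.IsMagnifier c) :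
    ENNReal.ofReal (c ^ 2 / (2 * (2 + floorAddSq c))) / (⨆ e, ENNReal.ofReal (G.length e)) ≤
      G.lam := by
  classical
  refine le_iInf fun f => le_iInf fun hf => le_iInf fun hne => ?_
  obtain ⟨B, hB⟩ := exists_finset_edges hf.1.1 hf.2.1
  set A := (finite_vertex_support hf.2.1).toFinset with hA
  set g : V → ℝ := fun v => f (vert v) with hg
  have hgA : ∀ x, x ∈ A ↔ g x ≠ 0 := fun x => by simp [hA, hg]
  have hreal := sq_mul_sum_sq_le hc hG A B g hgA hf.2.2 hB
  have hΦ0 : 0 ≤ floorAddSq c := by simpa [floorAddSq] using floorAddSq_mono hc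
  have hmass : sqMass f ≤ ENNReal.ofReal (∑ x ∈ A, g x ^ 2) := by
    refine (sqMass_le_tsum hV f).trans (le_of_eq ?_)
    rw [ENNReal.ofReal_sum_of_nonneg fun _ _ => sq_nonneg _]
    refine tsum_eq_sum fun v hv => ?_
    have : g v = 0 := by_contra fun h => hv ((hgA v).2 h)
    simp only [hg] at this
    simp [this]
  set L := ⨆ e, ENNReal.ofReal (G.length e) with hL
  have henergy : ENNReal.ofReal (∑ e ∈ B, (g (G.src e) - g (G.tgt e)) ^ 2) / L ≤ energy f := by
    refine le_trans ?_ (tsum_sq_sub_div_le_energy ha hf.1)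
    refine le_trans ?_ (ENNReal.sum_le_tsum B)
    rw [ENNReal.ofReal_sum_of_nonneg fun _ _ => sq_nonneg _, div_eq_mul_inv, Finset.sum_mul]
    refine Finset.sum_le_sum fun e _ => ?_
    rw [← div_eq_mul_inv]
    exact ENNReal.div_le_div_left (le_iSup (fun e => ENNReal.ofReal (G.length e)) e) _
  -- Clearing the denominator needs the mass nonzero and finite; finiteness comes from the finite
  -- vertex support.
  rw [rayleigh, ENNReal.le_div_iff_mul_le (Or.inl hne)
    (Or.inl (ne_top_of_le_ne_top ENNReal.ofReal_ne_top hmass))]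
  refine le_trans ?_ henergy
  rw [div_eq_mul_inv, div_eq_mul_inv, mul_right_comm]
  refine mul_le_mul_left ?_ _
  refine (mul_le_mul_right hmass _).trans ?_
  rw [← ENNReal.ofReal_mul (by positivity)]
  refine ENNReal.ofReal_le_ofReal ?_
  rw [← div_eq_mul_inv, div_mul_eq_mul_div, div_le_iff₀ (by positivity)]
  linarith

end CalcGraph

theorem floorAddSq_le_sq {c : ℝ} (hc : 0 ≤ c) : floorAddSq c ≤ c ^ 2 := by
  unfold floorAddSq
  have h0 : (0 : ℝ) ≤ ⌊c⌋ := by exact_mod_cast Int.floor_nonneg.2 hc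
  have h1 : (⌊c⌋ : ℝ) ≤ ⌊c⌋ ^ 2 := by exact_mod_cast Int.le_self_sq ⌊c⌋
  nlinarith [mul_nonneg h0 (sub_nonneg.2 (Int.floor_le c))]

/-- With n = ⌊c⌋ and a = c - n, the difference is (n² - n) + 2na: for a > 0 the second term is
positive, and for a = 0 the integer c = n exceeds 1. -/
theorem floorAddSq_lt_sq {c : ℝ} (hc : 1 < c) : floorAddSq c < c ^ 2 := by
  unfold floorAddSq
  have h0 : (1 : ℝ) ≤ ⌊c⌋ := by exact_mod_cast Int.le_floor.2 (by exact_mod_cast hc.le)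
  rcases (Int.floor_le c).eq_or_lt with h | h
  · rw [h]; nlinarith
  · nlinarith [mul_pos (sub_pos.2 h) (zero_lt_one.trans_le h0)]

theorem mainTheorem4 {V E : Type*} (G : CalcGraph V E)
    (hV : ∀ v, G.vertexWeight v = 1) (ha : ∀ e, G.edgeWeight e = 1)
    (c : ℝ) (hc : 0 ≤ c) (hG : G.IsMagnifier c) :
    -- unit edge lengths
    ((∀ e, G.length e = 1) →
      ENNReal.ofReal (c ^ 2 / (2 * c ^ 2 + 4)) ≤ G.lam ∧
      ENNReal.ofReal (c ^ 2 / (4 + 2 * (⌊c⌋ : ℝ) + 2 * (c - (⌊c⌋ : ℝ)) ^ 2)) ≤ G.lam) ∧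
    -- arbitrary edge lengths
    (ENNReal.ofReal (c ^ 2 / (2 * c ^ 2 + 4)) /
        (⨆ e, ENNReal.ofReal (G.length e)) ≤ G.lam ∧
      ENNReal.ofReal (c ^ 2 / (4 + 2 * (⌊c⌋ : ℝ) + 2 * (c - (⌊c⌋ : ℝ)) ^ 2)) /
        (⨆ e, ENNReal.ofReal (G.length e)) ≤ G.lam) ∧
    -- the second bound is at least the first, and is larger for `c > 1`
    c ^ 2 / (2 * c ^ 2 + 4) ≤ c ^ 2 / (4 + 2 * (⌊c⌋ : ℝ) + 2 * (c - (⌊c⌋ : ℝ)) ^ 2) ∧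
    (1 < c →
      c ^ 2 / (2 * c ^ 2 + 4) < c ^ 2 / (4 + 2 * (⌊c⌋ : ℝ) + 2 * (c - (⌊c⌋ : ℝ)) ^ 2)) := by
  have hΦ0 : 0 ≤ floorAddSq c := by simpa [floorAddSq] using floorAddSq_mono hc
  have hden : 4 + 2 * (⌊c⌋ : ℝ) + 2 * (c - (⌊c⌋ : ℝ)) ^ 2 = 2 * (2 + floorAddSq c) := by
    unfold floorAddSq
    ring
  rw [hden]
  have hle : c ^ 2 / (2 * c ^ 2 + 4) ≤ c ^ 2 / (2 * (2 + floorAddSq c)) :=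
    div_le_div_of_nonneg_left (sq_nonneg c) (by positivity) (by linarith [floorAddSq_le_sq hc])
  have hmain := CalcGraph.div_iSup_length_le_lam hV ha hc hG
  have hunit : (∀ e, G.length e = 1) →
      ENNReal.ofReal (c ^ 2 / (2 * (2 + floorAddSq c))) ≤ G.lam := by
    intro hl
    refine le_trans ?_ hmain
    -- Only ≤ 1 is claimed: without edges the supremum is 0.
    have hL : ⨆ e, ENNReal.ofReal (G.length e) ≤ 1 := iSup_le fun e => by simp [hl e]
    exact (div_one _).symm.le.trans (ENNReal.div_le_div_left hL _)
  refine ⟨fun hl => ⟨(ENNReal.ofReal_le_ofReal hle).trans (hunit hl), hunit hl⟩,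
    ⟨(ENNReal.div_le_div_right (ENNReal.ofReal_le_ofReal hle) _).trans hmain, hmain⟩, hle,
    fun h1 => div_lt_div_of_pos_left (by positivity) (by positivity)
      (by linarith [floorAddSq_lt_sq h1])⟩
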